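/- Let $\mathbb{N}$ be the set of positive integers, and let $[\mathbb{N}]^\infty$ be the set of all infinite subsets of $\mathbb{N}$. For $a\in[\mathbb{N}]^\infty$ let $a(n)$ be the $n$-th smallest element of $a$, and write $x\le^* y$ if $y(n)<x(n)$ for only finitely many $n$. Let $\mathfrak{d}$ be the minimal cardinality of a set $D\subseteq[\mathbb{N}]^\infty$ such that every $x\in[\mathbb{N}]^\infty$ satisfies $x\le^* y$ for some $y\in D$. Let $\mathfrak{r}$ be the minimal cardinality of a family $A\subseteq[\mathbb{N}]^\infty$ such that there is no $r\in[\mathbb{N}]^\infty$ for which both $a\cap r$ and $a\setminus r$ are infinite for all $a\in A$. A topological space $X$ is *Menger* if for each sequence $\mathcal{U}_1,\mathcal{U}_2,\dots$ of open covers of $X$ there are finite sets $\mathcal{F}_1\subseteq\mathcal{U}_1,\mathcal{F}_2\subseteq\mathcal{U}_2,\dots$ such that $\bigcup_n\mathcal{F}_n$ covers $X$. It is *Scheepers* if the finite sets $\mathcal{F}_n\subseteq\mathcal{U}_n$ can always be chosen so that each finite subset of $X$ is contained in $\bigcup\mathcal{F}_n$ for some $n$. Sets of reals are subsets of $\mathbb{R}$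 with the subspace topology. **Theorem.** Assume that $\mathfrak{d}\le\mathfrak{r}$ and that the cardinal $\mathfrak{d}$ is regular. Then there are sets $X,Y\subseteq\mathbb{R}$ such that all finite powers $X^n$ and $Y^n$ are Menger, the union $X\cup Y$ is not Scheepers, and the product space $X\times Y$ is not Menger. Moreover, among sets of reals the Scheepers property is neither additive nor productive: there are Scheepers sets $X,Y\subseteq\mathbb{R}$ whose union $X\cup Y$ is not Scheepers, and there are Scheepers sets $X,Y\subseteq\mathbb{R}$ whose product space $X\times Y$ is not Scheepers. -/

import Mathlib

open Set

namespace MengerProducts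

/-- The set of infinite sets of natural numbers. The natural numbers start at `0` here; the shift
`n ↦ n + 1` identifies this with the infinite sets of positive integers, together with the
enumerations and relations below. -/
abbrev Roth : Type := {a : Set ℕ // a.Infinite}

/-- The increasing enumeration of an infinite set of natural numbers. -/
noncomputable def Roth.enum (a : Roth) (n : ℕ) : ℕ := Nat.nth (fun k => k ∈ a.1) n

/-- `x ≤* y`: only finitely many `n` satisfy `y(n) < x(n)`. -/
def Roth.DominatedBy (x y : Roth) : Prop := {n : ℕ | y.enum n < x.enum n}.Finite

def IsDominating (D : Set Roth) : Prop := ∀ x : Roth, ∃ y ∈ D, x.DominatedBy y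

/-- The dominating number `𝔡`: the minimal cardinality of a dominating subset of `Roth`. -/
noncomputable def dominatingNumber : Cardinal.{0} :=
  sInf {κ | ∃ D : Set Roth, IsDominating D ∧ Cardinal.mk D = κ}

/-- `r` reaps the family `A`: it splits each member of `A` into two infinite parts. -/
def Reaps (r : Roth) (A : Set Roth) : Prop :=
  ∀ a ∈ A, (a.1 ∩ r.1).Infinite ∧ (a.1 \ r.1).Infinite

/-- The reaping number `𝔯`: the minimal cardinality of a family `A` that no set reaps. -/
noncomputable def reapingNumber : Cardinal.{0} :=
  sInf {κ | ∃ A : Set Roth, (∀ r : Roth, ¬ Reaps r A) ∧ Cardinal.mk A = κ}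

/-- The whole of `Roth` is dominating, so the infimum in `dominatingNumber` is a minimum. -/
theorem isDominating_univ : IsDominating univ :=
  fun x => ⟨x, mem_univ x, by simp [Roth.DominatedBy]⟩

/-- No set reaps the whole of `Roth`, so the infimum in `reapingNumber` is a minimum. -/
theorem not_reaps_univ (r : Roth) : ¬ Reaps r univ :=
  fun h => (h r (mem_univ r)).2 (by simp)

def IsOpenCover {X : Type*} [TopologicalSpace X] (U : Set (Set X)) : Prop :=
  (∀ u ∈ U, IsOpen u) ∧ ⋃₀ U = univ

/-- The Menger property of a topological space. -/
def Menger (X : Type*) [TopologicalSpace X] : Prop :=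
  ∀ U : ℕ → Set (Set X), (∀ n, IsOpenCover (U n)) →
    ∃ F : ℕ → Set (Set X), (∀ n, F n ⊆ U n ∧ (F n).Finite) ∧ ⋃ n, ⋃₀ F n = univ

/-- The Scheepers property of a topological space. -/
def Scheepers (X : Type*) [TopologicalSpace X] : Prop :=
  ∀ U : ℕ → Set (Set X), (∀ n, IsOpenCover (U n)) →
    ∃ F : ℕ → Set (Set X), (∀ n, F n ⊆ U n ∧ (F n).Finite) ∧
      ∀ S : Set X, S.Finite → ∃ n, S ⊆ ⋃₀ F n

/-- All finite powers of the space `X` are Menger (the zeroth power is a one-point space). -/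
def AllFinitePowersMenger (X : Type*) [TopologicalSpace X] : Prop :=
  ∀ n : ℕ, Menger (Fin n → X)

/-- A property of topological spaces. -/
abbrev SpaceProperty : Type 1 := ∀ (X : Type) [TopologicalSpace X], Prop

/-- Additivity of a property in the realm of sets of reals: the union of any two sets of reals
with the property has the property. -/
def IsAdditive (P : SpaceProperty) : Prop :=
  ∀ X Y : Set ℝ, P X → P Y → P (X ∪ Y : Set ℝ)

/-- Productivity of a property in the realm of sets of reals: the product space of any two sets
of reals with the property has the property. -/
def IsProductive (P : SpaceProperty) : Prop :=
  ∀ X Y : Set ℝ, P X → P Y → P (X × Y)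

end MengerProducts

/-! A recursion of length `𝔡` builds functions `b α` and sets `P α`, `Q α`. The set `X` codes the
unions of blocks `[n, b α n)` with `n ∈ P α`, together with all cofinite sets; `Y` does the same
with `Q α`. Cofinite sets play the part of a countable dense set.

Positive side: all `P α` and all `{n | D β n ≤ b α n}` with `β ≤ α`, where `D` is dominating, lie in
one proper filter of infinite sets. Modulo it `b` is a scale, and late points look cofinite on long
intervals, which makes all finite powers Menger (`allFinitePowersMenger_of_scale`). A second filter,
usually incompatible with the first, serves `Q`.

Negative side: `P α` and `Q α` are so far apart that no interval `[n, D α n)` meets blocks of both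
kinds (`blocks_separated`). The covers by sets hitting `[n, M)` then defeat both Scheepers for the
union and Menger for the product.

At each stage both filters have fewer than `𝔡` generators. Hence some `b α` is not dominated along
them (`exists_growth`), and since `𝔡 ≤ 𝔯` one set splits all the relevant infinite sets into a
`P`-side and a `Q`-side (`exists_separation`). Regularity keeps the bases small and bounds small
families of indices. -/

open Filter Topology

namespace MengerProducts

/-! ### Menger powers imply Scheepers -/

/-- A space all of whose finite powers are Menger is Scheepers. -/
theorem AllFinitePowersMenger.scheepers {X : Type*} [TopologicalSpace X]
    (h : AllFinitePowersMenger X) : Scheepers X := by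
  classical
  intro U hU
  -- Each exponent `k` gets its own infinite subsequence of the covers, so the selections for
  -- different powers do not interfere.
  let W (k n : ℕ) : Set (Set (Fin k → X)) :=
    {w | ∃ V : Set (Set X), V ⊆ U (Nat.pair k n) ∧ V.Finite ∧ w = {t | ∀ i, t i ∈ ⋃₀ V}}
  have hW (k n : ℕ) : IsOpenCover (W k n) := by
    constructor
    · rintro _ ⟨V, hVU, -, rfl⟩
      have hV : IsOpen (⋃₀ V) := isOpen_sUnion fun v hv => (hU _).1 v (hVU hv)
      simp only [ofPred_forall]
      exact isOpen_iInter_of_finite fun i => hV.preimage (continuous_apply i)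
    · refine eq_univ_of_forall fun t => ?_
      have ht (i : Fin k) : ∃ v ∈ U (Nat.pair k n), t i ∈ v := by
        have := (hU (Nat.pair k n)).2.ge (mem_univ (t i))
        simpa using this
      choose v hv htv using ht
      exact ⟨_, ⟨range v, range_subset_iff.2 hv, finite_range v, rfl⟩,
        fun i => ⟨v i, mem_range_self i, htv i⟩⟩
  choose F hF hFc using fun k => h k (W k) (hW k)
  have hFW (k n : ℕ) (w : F k n) : ∃ V : Set (Set X), V ⊆ U (Nat.pair k n) ∧ V.Finite ∧
      w.1 = {t | ∀ i, t i ∈ ⋃₀ V} := (hF k n).1 w.2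
  choose V hVU hVf hV using hFW
  refine ⟨fun p => ⋃ w, V (Nat.unpair p).1 (Nat.unpair p).2 w, fun p => ⟨?_, ?_⟩, fun S hS => ?_⟩
  · refine iUnion_subset fun w => (hVU _ _ w).trans ?_
    rw [Nat.pair_unpair]
  · have := (hF (Nat.unpair p).1 (Nat.unpair p).2).2.to_subtype
    exact finite_iUnion fun w => hVf _ _ w
  · obtain ⟨k, t, ht⟩ := hS.fin_param
    have hmem := (hFc k).ge (mem_univ t)
    obtain ⟨n, w, hw, htw⟩ := by simpa using hmem
    refine ⟨Nat.pair k n, fun x hx => ?_⟩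
    rw [← ht.2] at hx
    obtain ⟨i, rfl⟩ := hx
    have := hV k n ⟨w, hw⟩
    rw [show w = _ from this] at htw
    obtain ⟨v, hv, hxv⟩ := htw i
    refine ⟨v, ?_, hxv⟩
    rw [mem_iUnion, Nat.unpair_pair]
    exact ⟨_, hv⟩

/-! ### Covers by hitting sets -/

/-- The points whose associated set of natural numbers meets the interval `[n, M)`. -/
def hitting {W : Type*} (ι : W → ℕ → Bool) (n M : ℕ) : Set W :=
  {w | ∃ m, n ≤ m ∧ m < M ∧ ι w m = true}

theorem isOpen_hitting {W : Type*} [TopologicalSpace W] {ι : W → ℕ → Bool} (hι : Continuous ι)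
    (n M : ℕ) : IsOpen (hitting ι n M) := by
  simp only [hitting, ofPred_exists]
  refine isOpen_iUnion fun m => ?_
  have h : IsOpen {w | ι w m = true} :=
    (isOpen_discrete {true}).preimage ((continuous_apply m).comp hι)
  by_cases h' : n ≤ m ∧ m < M
  · simpa [h'.1, h'.2] using h
  · convert isOpen_empty
    ext w
    simp only [mem_ofPred_eq, mem_empty_iff_false, iff_false]
    tauto

theorem hitting_mono {W : Type*} (ι : W → ℕ → Bool) (n : ℕ) : Monotone (hitting ι n) :=
  fun _ _ h _ ⟨m, h1, h2, h3⟩ => ⟨m, h1, h2.trans_le h, h3⟩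

theorem exists_sUnion_subset_of_finite {W : Type*} {O : ℕ → Set W} (hO : Monotone O)
    {F : Set (Set W)} (hF : F.Finite) (hFO : F ⊆ range O) : ∃ M, ⋃₀ F ⊆ O M := by
  choose! g hg using hFO
  obtain ⟨M, hM⟩ := (hF.image g).bddAbove
  exact ⟨M, sUnion_subset fun s hs => (hg hs).ge.trans (hO (hM (mem_image_of_mem g hs)))⟩

/-- The `n`-th cover increases with `M`, so a finite selection amounts to one number `f n`; a pair
never caught together then refutes Scheepers. -/
theorem not_scheepers_of_hitting {W : Type*} [TopologicalSpace W] {ι : W → ℕ → Bool}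
    (hι : Continuous ι) (hinf : ∀ w n, ∃ m ≥ n, ι w m = true)
    (hdom : ∀ f : ℕ → ℕ, ∃ x y : W, ∀ n, ¬ (x ∈ hitting ι n (f n) ∧ y ∈ hitting ι n (f n))) :
    ¬ Scheepers W := by
  intro h
  obtain ⟨F, hF, hFc⟩ := h (fun n => range (hitting ι n)) fun n => by
    refine ⟨forall_mem_range.2 fun M => isOpen_hitting hι n M, eq_univ_of_forall fun w => ?_⟩
    obtain ⟨m, hm, hwm⟩ := hinf w n
    exact ⟨_, mem_range_self (m + 1), m, hm, m.lt_succ_self, hwm⟩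
  choose f hf using fun n => exists_sUnion_subset_of_finite (hitting_mono ι n) (hF n).2 (hF n).1
  obtain ⟨x, y, hxy⟩ := hdom f
  obtain ⟨n, hn⟩ := hFc {x, y} (by simp)
  exact hxy n ⟨hf n (hn (by simp)), hf n (hn (by simp))⟩

theorem not_menger_prod_of_hitting {X Y : Type*} [TopologicalSpace X] [TopologicalSpace Y]
    {ι : X → ℕ → Bool} (hι : Continuous ι) (hinf : ∀ w n, ∃ m ≥ n, ι w m = true)
    {ι' : Y → ℕ → Bool} (hι' : Continuous ι') (hinf' : ∀ w n, ∃ m ≥ n, ι' w m = true)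
    (hdom : ∀ f : ℕ → ℕ, ∃ (x : X) (y : Y), ∀ n,
      ¬ (x ∈ hitting ι n (f n) ∧ y ∈ hitting ι' n (f n))) :
    ¬ Menger (X × Y) := by
  intro h
  obtain ⟨F, hF, hFc⟩ := h (fun n => range fun M => hitting ι n M ×ˢ hitting ι' n M) fun n => by
    refine ⟨forall_mem_range.2 fun M => (isOpen_hitting hι n M).prod (isOpen_hitting hι' n M),
      eq_univ_of_forall fun w => ?_⟩
    obtain ⟨m, hm, hwm⟩ := hinf w.1 n
    obtain ⟨m', hm', hwm'⟩ := hinf' w.2 n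
    exact ⟨_, mem_range_self (max m m' + 1), ⟨m, hm, by omega, hwm⟩, ⟨m', hm', by omega, hwm'⟩⟩
  choose f hf using fun n => exists_sUnion_subset_of_finite
    (fun _ _ h => prod_mono (hitting_mono ι n h) (hitting_mono ι' n h)) (hF n).2 (hF n).1
  obtain ⟨x, y, hxy⟩ := hdom f
  obtain ⟨n, hn⟩ := mem_iUnion.1 (hFc.ge (mem_univ (x, y)))
  exact hxy n (hf n hn)

/-! ### Scales modulo a filter and Menger powers -/

/-- Open sets of a power of a subspace of the Cantor space contain basic neighbourhoods. -/
theorem exists_agree_subset {X : Type*} [TopologicalSpace X] {ι : X → ℕ → Bool}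
    (hι : IsInducing ι) {k : ℕ} {O : Set (Fin k → X)} (hO : IsOpen O) {t : Fin k → X}
    (ht : t ∈ O) :
    ∃ m, ∀ t' : Fin k → X, (∀ i, ∀ l < m, ι (t' i) l = ι (t i) l) → t' ∈ O := by
  obtain ⟨u, hu, huO⟩ := isOpen_pi_iff'.1 hO t ht
  have key (i : Fin k) : ∃ m, ∀ x : X, (∀ l < m, ι x l = ι (t i) l) → x ∈ u i := by
    obtain ⟨v, hv, hvu⟩ := hι.isOpen_iff.1 (hu i).1
    have hti : ι (t i) ∈ v := by
      have := (hu i).2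
      rwa [← hvu] at this
    obtain ⟨_, ⟨y, n, rfl⟩, hmem, hsub⟩ :=
      (PiNat.isTopologicalBasis_cylinders (fun _ : ℕ => Bool)).exists_subset_of_mem_open hti hv
    refine ⟨n, fun x hx => ?_⟩
    rw [← hvu]
    exact hsub fun l hl => (hx l hl).trans (hmem l hl)
  choose m hm using key
  refine ⟨Finset.univ.sup m, fun t' ht' => huO fun i _ => hm i _ fun l hl => ht' i l ?_⟩
  exact hl.trans_le (Finset.le_sup (f := m) (Finset.mem_univ i))

/-- For a fixed open cover of a power, a single bound serves all tuples with prescribed coordinates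
`u γ` at some places and long initial gaps at the other ones. -/
theorem exists_bound_of_partial_tuple {I X : Type*} [TopologicalSpace X] {ι : X → ℕ → Bool}
    {u : I → X} (hι : IsInducing ι)
    (hQ : ∀ z : ℕ → Bool, (∃ N, ∀ n ≥ N, z n = true) → ∃ x, ι x = z) {k : ℕ}
    {V : ℕ → Set (Fin k → X)} (hV : ∀ j, IsOpen (V j)) (hVc : ⋃ j, V j = univ)
    (z : Fin k → Option I) (n : ℕ) :
    ∃ m, ∀ t : Fin k → X, (∀ i, (∃ γ, z i = some γ ∧ t i = u γ) ∨
      (z i = none ∧ ∀ l, n ≤ l → l < m → ι (t i) l = true)) → ∃ j < m, t ∈ V j := by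
  classical
  have hq (σ : Fin n → Bool) :
      ∃ x : X, ι x = fun l => if h : l < n then σ ⟨l, h⟩ else true :=
    hQ _ ⟨n, fun l hl => by simp [not_lt.2 hl]⟩
  choose q hq using hq
  -- Only finitely many patterns exist below `n`. Completing each by `true` gives finitely many
  -- model tuples, and their neighbourhoods yield the bound.
  let T (s : Fin k → Fin n → Bool) (i : Fin k) : X := (z i).elim (q (s i)) u
  have hT (s : Fin k → Fin n → Bool) : ∃ j m, ∀ t' : Fin k → X,
      (∀ i, ∀ l < m, ι (t' i) l = ι (T s i) l) → t' ∈ V j := by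
    obtain ⟨j, hj⟩ := mem_iUnion.1 (hVc.ge (mem_univ (T s)))
    exact ⟨j, exists_agree_subset hι (hV j) hj⟩
  choose j m hm using hT
  refine ⟨Finset.univ.sup fun s => max (m s) (j s + 1), fun t ht => ?_⟩
  let s : Fin k → Fin n → Bool := fun i l => ι (t i) l
  have hs := Finset.le_sup (f := fun s => max (m s) (j s + 1)) (Finset.mem_univ s)
  refine ⟨j s, (Nat.lt_succ_self _).trans_le ((le_max_right _ _).trans hs),
    hm s t fun i l hl => ?_⟩
  rcases ht i with ⟨γ, hz, hγ⟩ | ⟨hz, hz'⟩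
  · simp [T, hz, hγ]
  · simp only [T, hz, Option.elim_none, hq]
    split_ifs with h
    · rfl
    · exact hz' l (not_lt.1 h) (hl.trans_le ((le_max_left _ _).trans hs))

section Scale

variable {I X : Type*} [LinearOrder I] [TopologicalSpace X] {ι : X → ℕ → Bool} {u : I → X}

variable {F : Filter ℕ} {b : I → ℕ → ℕ}

/-- Fix which coordinates have index below `α`, and which index. By `hbdd` one `β` is late enough
for every such pattern; the other coordinates then look cofinite on the required interval for
`F`-many `n`, and one scale function bounds all choices. -/
theorem exists_selection_of_scale [NeBot F] (hF : F ≤ cofinite) (hι : IsInducing ι)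
    (hQ : ∀ z : ℕ → Bool, (∃ N, ∀ n ≥ N, z n = true) → ∃ x, ι x = z)
    (hb : ∀ f : ℕ → ℕ, ∃ β, ∀ α ≥ β, ∀ᶠ n in F, f n ≤ b α n)
    (hu : ∀ f : ℕ → ℕ, ∃ β, ∀ α ≥ β, ∀ᶠ n in F, ∀ m, n ≤ m → m < f n → ι (u α) m = true)
    (hbdd : ∀ (α : I) (k : ℕ) (h : (Fin k → Option (Iio α)) → I), ∃ β, ∀ z, h z ≤ β)
    {k : ℕ} {V : ℕ → ℕ → Set (Fin k → X)} (hV : ∀ n j, IsOpen (V n j))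
    (hVc : ∀ n, ⋃ j, V n j = univ) (α : I) :
    ∃ β ≥ α, ∃ g : ℕ → ℕ, ∀ t : Fin k → X,
      (∀ i, (∃ N, ∀ n ≥ N, ι (t i) n = true) ∨ ∃ γ, t i = u γ ∧ (γ < α ∨ β ≤ γ)) →
      ∃ n, ∃ j < g n, t ∈ V n j := by
  classical
  choose f hf using fun (z : Fin k → Option (Iio α)) n =>
    exists_bound_of_partial_tuple (u := u) hι hQ (hV n) (hVc n)
      (fun i => (z i).map Subtype.val) n
  choose β₁ hβ₁ using fun z => hb (f z)
  choose β₂ hβ₂ using fun z => hu (f z)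
  obtain ⟨β, hβ⟩ := hbdd α k fun z => max (β₁ z) (β₂ z)
  refine ⟨max α β, le_max_left _ _, b (max α β), fun t ht => ?_⟩
  have hz (i : Fin k) : ∃ o : Option (Iio α), (∃ γ, o = some γ ∧ t i = u γ) ∨
      (o = none ∧ ((∃ N, ∀ n ≥ N, ι (t i) n = true) ∨ ∃ γ, t i = u γ ∧ β ≤ γ)) := by
    rcases ht i with h | ⟨γ, hγ, h | h⟩
    · exact ⟨none, Or.inr ⟨rfl, Or.inl h⟩⟩
    · exact ⟨some ⟨γ, h⟩, Or.inl ⟨_, rfl, hγ⟩⟩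
    · exact ⟨none, Or.inr ⟨rfl, Or.inr ⟨γ, hγ, (le_max_right _ _).trans h⟩⟩⟩
  choose z hz using hz
  have h1 : ∀ᶠ n in F, f z n ≤ b (max α β) n :=
    hβ₁ z _ ((le_max_left _ _).trans ((hβ z).trans (le_max_right _ _)))
  have h2 : ∀ᶠ n in F, ∀ i, z i = none → ∀ l, n ≤ l → l < f z n → ι (t i) l = true := by
    refine eventually_all.2 fun i => ?_
    rcases hz i with ⟨γ, hγ, -⟩ | ⟨-, ⟨N, hN⟩ | ⟨γ, hγ, hle⟩⟩
    · simp [hγ]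
    · have : ∀ᶠ n in F, N ≤ n := by
        refine hF ?_
        rw [Nat.cofinite_eq_atTop]
        exact Ici_mem_atTop N
      filter_upwards [this] with n hn _ l hl _ using hN l (hn.trans hl)
    · rw [hγ]
      filter_upwards [hβ₂ z γ ((le_max_right _ _).trans ((hβ z).trans hle))] with n hn _ using hn
  obtain ⟨n, hn1, hn2⟩ := (h1.and h2).exists
  obtain ⟨j, hj, htj⟩ := hf z n t fun i => by
    rcases hz i with ⟨γ, hγ, htγ⟩ | ⟨hi, -⟩
    · exact Or.inl ⟨γ, by simp [hγ], htγ⟩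
    · exact Or.inr ⟨by simp [hi], hn2 i hi⟩
  exact ⟨n, j, hj.trans_le hn1, htj⟩

/-- A scale with respect to a filter, together with the cofinite sets, is Menger in all finite
powers. -/
theorem allFinitePowersMenger_of_scale [Nonempty I] [NeBot F] (hF : F ≤ cofinite)
    (hι : IsInducing ι)
    (hQ : ∀ z : ℕ → Bool, (∃ N, ∀ n ≥ N, z n = true) → ∃ x, ι x = z)
    (hX : ∀ x, (∃ N, ∀ n ≥ N, ι x n = true) ∨ ∃ γ, x = u γ)
    (hb : ∀ f : ℕ → ℕ, ∃ β, ∀ α ≥ β, ∀ᶠ n in F, f n ≤ b α n)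
    (hu : ∀ f : ℕ → ℕ, ∃ β, ∀ α ≥ β, ∀ᶠ n in F, ∀ m, n ≤ m → m < f n → ι (u α) m = true)
    (hbdd : ∀ (α : I) (k : ℕ) (h : (Fin k → Option (Iio α)) → I), ∃ β, ∀ z, h z ≤ β) :
    AllFinitePowersMenger X := by
  classical
  intro k U hU
  have : Nonempty X := (hQ (fun _ => true) ⟨0, fun _ _ => rfl⟩).nonempty
  have : SecondCountableTopology X := hι.secondCountableTopology
  have hLind (n : ℕ) : ∃ V : ℕ → Set (Fin k → X), range V ⊆ U n ∧ ⋃ j, V j = univ := by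
    obtain ⟨T, hTc, hTU, hT⟩ := TopologicalSpace.isOpen_sUnion_countable (U n) (hU n).1
    rw [(hU n).2] at hT
    have hTne : T.Nonempty := by
      rw [nonempty_iff_ne_empty]
      rintro rfl
      rw [sUnion_empty] at hT
      exact empty_ne_univ hT
    obtain ⟨V, rfl⟩ := hTc.exists_eq_range hTne
    exact ⟨V, hTU, by rw [← sUnion_range, hT]⟩
  choose V hVU hVc using hLind
  have hV (n j : ℕ) : IsOpen (V n j) := (hU n).1 _ (hVU n (mem_range_self j))
  choose next hnext g hg using exists_selection_of_scale hF hι hQ hb hu hbdd hV hVc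
  let a (j : ℕ) : I := next^[j] (Classical.arbitrary I)
  have ha (j : ℕ) : a (j + 1) = next (a j) := Function.iterate_succ_apply' ..
  have hmono : Monotone a := monotone_nat_of_le_succ fun j => (hnext (a j)).trans_eq (ha j).symm
  refine ⟨fun n => V n '' Iio ((Finset.range (k + 1)).sup fun j => g (a j) n), fun n =>
    ⟨(image_subset_range _ _).trans (hVU n), (finite_Iio _).image _⟩,
    eq_univ_of_forall fun t => ?_⟩
  -- Pigeonhole: the `k + 1` gaps `[a j, next (a j))` are disjoint, so the indices of `k`
  -- coordinates miss one of them.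
  have hgood : ∃ j < k + 1, ∀ i, (∃ N, ∀ n ≥ N, ι (t i) n = true) ∨
      ∃ γ, t i = u γ ∧ (γ < a j ∨ next (a j) ≤ γ) := by
    by_contra! hbad
    choose i hi hi' using fun j : Fin (k + 1) => hbad j j.2
    have hinj : ∀ j j' : Fin (k + 1), j < j' → i j ≠ i j' := by
      intro j j' hjj' heq
      obtain ⟨γ, hγ⟩ := (hX (t (i j))).resolve_left (by simpa using hi j)
      have h1 := (hi' j γ hγ).2
      have h2 := (hi' j' γ (heq ▸ hγ)).1
      rw [← ha] at h1
      exact (h1.trans_le (hmono (Nat.succ_le_of_lt hjj'))).not_ge h2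
    have : Function.Injective i := fun j j' h => by
      rcases lt_trichotomy j j' with hlt | heq | hlt
      · exact (hinj _ _ hlt h).elim
      · exact heq
      · exact (hinj _ _ hlt h.symm).elim
    simpa using Fintype.card_le_of_injective i this
  obtain ⟨j, hjk, hj⟩ := hgood
  obtain ⟨n, l, hl, htl⟩ := hg (a j) t hj
  refine mem_iUnion.2 ⟨n, V n l, mem_image_of_mem _ ?_, htl⟩
  exact hl.trans_le
    (Finset.le_sup (f := fun j => g (a j) n) (Finset.mem_range.2 hjk))

end Scale

/-! ### Using the cardinals `𝔡` and `𝔯` -/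

open Cardinal

theorem exists_roth_enum_eq {g : ℕ → ℕ} (hg : StrictMono g) : ∃ x : Roth, x.enum = g := by
  refine ⟨⟨range g, infinite_range_of_injective hg.injective⟩, funext fun n => ?_⟩
  have := Nat.nth_comp_of_strictMono (p := fun k => k ∈ range g) (n := n) hg (fun _ h => h)
    fun hf => (infinite_range_of_injective hg.injective hf).elim
  simpa [Roth.enum] using this.symm

theorem Roth.strictMono_enum (x : Roth) : StrictMono x.enum :=
  Nat.nth_strictMono x.2

theorem exists_roth_le_enum (f : ℕ → ℕ) : ∃ x : Roth, ∀ n, f n ≤ x.enum n := by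
  obtain ⟨x, hx⟩ := exists_roth_enum_eq (g := fun n => ∑ i ∈ Finset.range (n + 1), (f i + 1))
    (strictMono_nat_of_lt_succ fun n => by
      rw [Finset.sum_range_succ _ (n + 1)]
      omega)
  refine ⟨x, fun n => ?_⟩
  rw [hx]
  simp only [Finset.sum_range_succ]
  omega

theorem exists_strictMono_frequently_lt {J : Type} (hJ : #J < dominatingNumber)
    (c : J → ℕ → ℕ) : ∃ b : ℕ → ℕ, StrictMono b ∧ ∀ j, {n | c j n < b n}.Infinite := by
  choose x hx using fun j => exists_roth_le_enum (c j)
  have hlt : #(range x) < dominatingNumber := mk_range_le.trans_lt hJ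
  have hnd : ¬ IsDominating (range x) := fun h =>
    notMem_of_lt_csInf' hlt ⟨_, h, rfl⟩
  simp only [IsDominating, not_forall, not_exists, not_and] at hnd
  obtain ⟨y, hy⟩ := hnd
  refine ⟨y.enum, y.strictMono_enum, fun j => ?_⟩
  exact Set.Infinite.mono (fun n hn => (hx j n).trans_lt hn) (hy (x j) (mem_range_self j))

/-- Adding every constant to the members of a dominating set absorbs the finitely many exceptions,
at no cost in cardinality. -/
theorem exists_dominating_family (h : ℵ₀ ≤ dominatingNumber) :
    ∃ D : dominatingNumber.ord.ToType → ℕ → ℕ, (∀ α, Monotone (D α)) ∧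
      ∀ f : ℕ → ℕ, ∃ α, ∀ n, f n ≤ D α n := by
  obtain ⟨D, hD, hcard⟩ : dominatingNumber ∈
      {κ | ∃ D : Set Roth, IsDominating D ∧ Cardinal.mk D = κ} :=
    csInf_mem ⟨_, univ, isDominating_univ, rfl⟩
  have hmk : #dominatingNumber.ord.ToType = #(D × ℕ) := by
    rw [mk_ord_toType, mk_prod, lift_id, lift_id, hcard, mk_nat, mul_eq_left h h aleph0_ne_zero]
  obtain ⟨e⟩ := Cardinal.eq.1 hmk
  refine ⟨fun α n => (e α).1.1.enum n + (e α).2,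
    fun α => (e α).1.1.strictMono_enum.monotone.add_const _, fun f => ?_⟩
  obtain ⟨x, hx⟩ := exists_roth_le_enum f
  obtain ⟨y, hy, hxy⟩ := hD x
  obtain ⟨k, hk⟩ := (hxy.image f).bddAbove
  refine ⟨e.symm (⟨y, hy⟩, k), fun n => ?_⟩
  simp only [Equiv.apply_symm_apply]
  by_cases hn : y.enum n < x.enum n
  · exact (hk (mem_image_of_mem f hn)).trans (Nat.le_add_left _ _)
  · have := hx n
    omega

theorem exists_reaping {J : Type} (hJ : #J < reapingNumber) (a : J → Set ℕ)
    (ha : ∀ j, (a j).Infinite) : ∃ r : Set ℕ, ∀ j, (a j ∩ r).Infinite ∧ (a j \ r).Infinite := by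
  have hlt : #(range fun j => (⟨a j, ha j⟩ : Roth)) < reapingNumber := mk_range_le.trans_lt hJ
  obtain ⟨r, hr⟩ : ∃ r, Reaps r (range fun j => (⟨a j, ha j⟩ : Roth)) := by
    by_contra h
    exact notMem_of_lt_csInf' hlt ⟨_, fun r hr => h ⟨r, hr⟩, rfl⟩
  exact ⟨r.1, fun j => hr _ (mem_range_self j)⟩

/-! ### Filters with small bases -/

/-- The filter is generated by fewer than `κ` sets. -/
def HasSmallBase (κ : Cardinal.{0}) (F : Filter ℕ) : Prop :=
  ∃ (ι : Type) (s : ι → Set ℕ), #ι < κ ∧ F = ⨅ i, 𝓟 (s i)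

theorem mk_finset_lt {κ : Cardinal.{0}} (hκ : ℵ₀ ≤ κ) {ι : Type} (h : #ι < κ) :
    #(Finset ι) < κ := by
  cases finite_or_infinite ι
  · exact (lt_aleph0_of_finite _).trans_le hκ
  · rwa [mk_finset_of_infinite]

theorem HasSmallBase.exists_hasBasis {κ : Cardinal.{0}} (hκ : ℵ₀ ≤ κ) {F : Filter ℕ}
    (h : HasSmallBase κ F) : ∃ (J : Type) (A : J → Set ℕ), #J < κ ∧
      F.HasBasis (fun _ => True) A := by
  obtain ⟨ι, s, hι, rfl⟩ := h
  refine ⟨Finset ι, fun t => ⋂ i ∈ t, s i, mk_finset_lt hκ hι, ⟨fun A => ?_⟩⟩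
  rw [(hasBasis_iInf_principal_finite s).mem_iff]
  constructor
  · rintro ⟨t, ht, htA⟩
    exact ⟨ht.toFinset, trivial, by simpa using htA⟩
  · rintro ⟨t, -, htA⟩
    exact ⟨t, t.finite_toSet, by simpa using htA⟩

theorem HasSmallBase.principal {κ : Cardinal.{0}} (hκ : ℵ₀ ≤ κ) (s : Set ℕ) :
    HasSmallBase κ (𝓟 s) :=
  ⟨Unit, fun _ => s, (lt_aleph0_of_finite _).trans_le hκ, by simp⟩

theorem HasSmallBase.iInf {κ : Cardinal.{0}} (hκ : κ.IsRegular) {J : Type} (hJ : #J < κ)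
    {F : J → Filter ℕ} (h : ∀ j, HasSmallBase κ (F j)) : HasSmallBase κ (⨅ j, F j) := by
  choose ι s hι hF using h
  refine ⟨Σ j, ι j, fun p => s p.1 p.2, ?_, ?_⟩
  · rw [mk_sigma]
    exact sum_lt_of_isRegular hκ hJ hι
  · simp only [iInf_sigma, hF]

theorem HasSmallBase.inf {κ : Cardinal.{0}} (hκ : ℵ₀ ≤ κ) {F G : Filter ℕ}
    (hF : HasSmallBase κ F) (hG : HasSmallBase κ G) : HasSmallBase κ (F ⊓ G) := by
  obtain ⟨ι, s, hι, rfl⟩ := hF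
  obtain ⟨ι', s', hι', rfl⟩ := hG
  refine ⟨ι ⊕ ι', Sum.elim s s', ?_, by simp [iInf_sum]⟩
  rw [mk_sum, lift_id, lift_id]
  exact add_lt_of_lt hκ hι hι'

theorem neBot_cofinite_inf_iff {F : Filter ℕ} :
    (cofinite ⊓ F).NeBot ↔ ∀ A ∈ F, A.Infinite := by
  rw [inf_neBot_iff_frequently_right]
  constructor
  · intro h A hA
    exact frequently_cofinite_iff_infinite.1 (h (p := fun n => n ∈ A) hA)
  · intro h p hp
    exact frequently_cofinite_iff_infinite.2 (h _ hp)

/-! ### A single stage: growth and separation -/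

/-- Evaluate the bounds `c t` at the next element of a base set after `n`. If `b n` exceeds this
value, monotonicity carries the inequality to that element, so escaping fewer than `𝔡` functions
suffices for both filters. -/
theorem exists_growth {F G : Filter ℕ} (hd : ℵ₀ ≤ dominatingNumber)
    (hF : HasSmallBase dominatingNumber F) (hG : HasSmallBase dominatingNumber G)
    (hFc : (cofinite ⊓ F).NeBot) (hGc : (cofinite ⊓ G).NeBot)
    {T : Type} (hT : #T < dominatingNumber) (c : T → ℕ → ℕ)
    {g : ℕ → ℕ} (hg : Monotone g) :
    ∃ b : ℕ → ℕ, Monotone b ∧ (∀ n, n < b n) ∧ (∀ n, g n ≤ b n) ∧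
      (cofinite ⊓ (F ⊓ ⨅ t, 𝓟 {n | c t n ≤ b n})).NeBot ∧
      (cofinite ⊓ (G ⊓ ⨅ t, 𝓟 {n | c t n ≤ b n})).NeBot := by
  classical
  obtain ⟨JF, A, hJF, hA⟩ := hF.exists_hasBasis hd
  obtain ⟨JG, B, hJG, hB⟩ := hG.exists_hasBasis hd
  rw [neBot_cofinite_inf_iff] at hFc hGc
  have hC (j : JF ⊕ JG) : (Sum.elim A B j).Infinite := by
    cases j with
    | inl j => exact hFc _ (hA.mem_of_mem trivial)
    | inr j => exact hGc _ (hB.mem_of_mem trivial)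
  choose next hmem hnext using fun j n => (hC j).exists_gt n
  have hJ : #((JF ⊕ JG) × Finset T) < dominatingNumber := by
    rw [mk_prod, lift_id, lift_id, mk_sum, lift_id, lift_id]
    exact mul_lt_of_lt hd (add_lt_of_lt hd hJF hJG) (mk_finset_lt hd hT)
  obtain ⟨b, hb, hbc⟩ := exists_strictMono_frequently_lt hJ
    fun p n => p.2.sup fun t => c t (next p.1 n)
  -- The `+ 1` ensures `n < b' n`: blocks contain their left endpoints and iterates increase
  -- strictly.
  let b' (n : ℕ) : ℕ := max (b n) (g n) + 1
  have hb' : Monotone b' := fun m n h =>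
    Nat.succ_le_succ (max_le_max (hb.monotone h) (hg h))
  have key (j : JF ⊕ JG) (S : Finset T) :
      (Sum.elim A B j ∩ ⋂ t ∈ S, {n | c t n ≤ b' n}).Infinite := by
    refine infinite_of_forall_exists_gt fun N => ?_
    obtain ⟨n, hn, hNn⟩ := (hbc (j, S)).exists_gt N
    refine ⟨next j n, ⟨hmem j n, ?_⟩, hNn.trans (hnext j n)⟩
    refine mem_iInter₂.2 fun t ht => ?_
    have h1 : c t (next j n) ≤ S.sup fun t => c t (next j n) :=
      Finset.le_sup (f := fun t => c t (next j n)) ht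
    have h2 : b n ≤ b (next j n) := hb.monotone (hnext j n).le
    have h3 : (S.sup fun t => c t (next j n)) < b n := hn
    have h4 := le_max_left (b (next j n)) (g (next j n))
    show c t (next j n) ≤ max (b (next j n)) (g (next j n)) + 1
    omega
  refine ⟨b', hb', fun n => ?_, fun n => (le_max_right _ _).trans (Nat.le_succ _), ?_, ?_⟩
  · exact Nat.lt_succ_of_le ((hb.id_le n).trans (le_max_left _ _))
  · rw [neBot_cofinite_inf_iff]
    intro E hE
    obtain ⟨⟨j, S⟩, ⟨-, hS⟩, hsub⟩ := (hA.inf (hasBasis_iInf_principal_finite _)).mem_iff.1 hE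
    refine (key (Sum.inl j) hS.toFinset).mono (subset_trans ?_ hsub)
    simp
  · rw [neBot_cofinite_inf_iff]
    intro E hE
    obtain ⟨⟨j, S⟩, ⟨-, hS⟩, hsub⟩ := (hB.inf (hasBasis_iInf_principal_finite _)).mem_iff.1 hE
    refine (key (Sum.inr j) hS.toFinset).mono (subset_trans ?_ hsub)
    simp

/-- The iterates of `h` at `0` partition the natural numbers into consecutive intervals. -/
theorem exists_iterate_index {h : ℕ → ℕ} (hlt : ∀ n, n < h n) :
    ∃ κ : ℕ → ℕ, ∀ n, h^[κ n] 0 ≤ n ∧ n < h^[κ n + 1] 0 := by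
  classical
  have hs (k : ℕ) : h^[k] 0 < h^[k + 1] 0 := by
    rw [Function.iterate_succ_apply']
    exact hlt _
  have hex (n : ℕ) : ∃ k, n < h^[k + 1] 0 :=
    ⟨n, Nat.lt_of_succ_le ((strictMono_nat_of_lt_succ hs).id_le (n + 1))⟩
  refine ⟨fun n => Nat.find (hex n), fun n => ⟨?_, Nat.find_spec (hex n)⟩⟩
  change h^[Nat.find (hex n)] 0 ≤ n
  rcases hk : Nat.find (hex n) with _ | k
  · simp
  · exact not_lt.1 (Nat.find_min (hex n) (m := k) (by omega))

/-- Cut `ℕ` into intervals by iterating `h` and group them in threes, with `P` confined to middle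
intervals. A set splitting the groups gives some to `P` and the others to `Q`; points of `P` and `Q`
are then at least two intervals apart, hence `h`-far. -/
theorem exists_separation {F G : Filter ℕ} {κ : Cardinal.{0}} (hκ : ℵ₀ ≤ κ)
    (hκr : κ ≤ reapingNumber) (hF : HasSmallBase κ F) (hG : HasSmallBase κ G)
    (hFc : (cofinite ⊓ F).NeBot) (hGc : (cofinite ⊓ G).NeBot)
    {h : ℕ → ℕ} (hmono : Monotone h) (hlt : ∀ n, n < h n) :
    ∃ P Q : Set ℕ, (cofinite ⊓ (F ⊓ 𝓟 P)).NeBot ∧ (cofinite ⊓ (G ⊓ 𝓟 Q)).NeBot ∧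
      ∀ p ∈ P, ∀ q ∈ Q, h p ≤ q ∨ h q ≤ p := by
  obtain ⟨JF, A, hJF, hA⟩ := hF.exists_hasBasis hκ
  obtain ⟨JG, B, hJG, hB⟩ := hG.exists_hasBasis hκ
  obtain ⟨k, hk⟩ := exists_iterate_index hlt
  have hit : Monotone fun j => h^[j] 0 := monotone_nat_of_le_succ fun j => by
    rw [Function.iterate_succ_apply']
    exact (hlt _).le
  have hfar (p q : ℕ) (hpq : k p + 2 ≤ k q) : h p ≤ q :=
    calc h p ≤ h (h^[k p + 1] 0) := hmono (hk p).2.le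
      _ = h^[k p + 2] 0 := (Function.iterate_succ_apply' ..).symm
      _ ≤ h^[k q] 0 := hit hpq
      _ ≤ q := (hk q).1
  let U := Ultrafilter.of (cofinite ⊓ F)
  have hU : (U : Filter ℕ) ≤ cofinite ⊓ F := Ultrafilter.of_le _
  -- An ultrafilter chooses one residue class that stays infinite on every set of `F`; the shift `a`
  -- turns it into the middle class.
  obtain ⟨a, ha⟩ : ∃ a, ∀ᶠ n in U, (k n + a) % 3 = 1 := by
    have : ∀ᶠ n in U, (k n + 0) % 3 = 1 ∨ (k n + 1) % 3 = 1 ∨ (k n + 2) % 3 = 1 :=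
      Eventually.of_forall fun n => by omega
    rw [Ultrafilter.eventually_or, Ultrafilter.eventually_or] at this
    rcases this with h | h | h <;> exact ⟨_, h⟩
  let R : Set ℕ := {n | (k n + a) % 3 = 1}
  let σ (n : ℕ) : ℕ := (k n + a) / 3
  have hσ {E : Set ℕ} (hE : E.Infinite) : (σ '' E).Infinite := by
    intro hfin
    obtain ⟨M, hM⟩ := hfin.bddAbove
    refine hE ((finite_Iio (h^[3 * M + 3] 0)).subset fun n hn => ?_)
    have h1 : (k n + a) / 3 ≤ M := hM (mem_image_of_mem σ hn)
    exact (hk n).2.trans_le (hit (by omega : k n + 1 ≤ 3 * M + 3))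
  have hAR (j : JF) : (A j ∩ R).Infinite := by
    have h1 : A j ∩ R ∈ U := inter_mem (hU (mem_inf_of_right (hA.mem_of_mem trivial))) ha
    have h2 : (cofinite ⊓ (U : Filter ℕ)).NeBot := by
      rw [inf_eq_right.2 (hU.trans inf_le_left)]
      infer_instance
    exact neBot_cofinite_inf_iff.1 h2 _ h1
  have hBi (j : JG) : (B j).Infinite := neBot_cofinite_inf_iff.1 hGc _ (hB.mem_of_mem trivial)
  have hJ : #(JF ⊕ JG) < reapingNumber := by
    rw [mk_sum, lift_id, lift_id]
    exact (add_lt_of_lt hκ hJF hJG).trans_le hκr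
  obtain ⟨r, hr⟩ := exists_reaping hJ
    (Sum.elim (fun j => σ '' (A j ∩ R)) (fun j => σ '' B j)) (by
      rintro (j | j)
      · exact hσ (hAR j)
      · exact hσ (hBi j))
  refine ⟨R ∩ σ ⁻¹' r, σ ⁻¹' rᶜ, ?_, ?_, ?_⟩
  · rw [neBot_cofinite_inf_iff]
    intro E hE
    obtain ⟨j, -, hj⟩ := (hA.inf_principal _).mem_iff.1 hE
    have h1 := (hr (Sum.inl j)).1
    rw [Sum.elim_inl, ← image_inter_preimage, inter_assoc] at h1
    exact h1.of_image.mono hj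
  · rw [neBot_cofinite_inf_iff]
    intro E hE
    obtain ⟨j, -, hj⟩ := (hB.inf_principal _).mem_iff.1 hE
    have h1 := (hr (Sum.inr j)).2
    rw [Sum.elim_inr, sdiff_eq, ← image_inter_preimage] at h1
    exact h1.of_image.mono hj
  · rintro p ⟨hpR, hpr⟩ q hq
    have hpR' : (k p + a) % 3 = 1 := hpR
    have hne : (k p + a) / 3 ≠ (k q + a) / 3 := fun heq => hq (by
      have : σ p = σ q := heq
      rw [← this]
      exact hpr)
    by_cases hpq : k p + 2 ≤ k q
    · exact Or.inl (hfar p q hpq)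
    · exact Or.inr (hfar q p (by omega))

/-! ### The transfinite construction -/

theorem exists_transfinite_rec {I T : Type*} [LinearOrder I] [WellFoundedLT I] [Nonempty T]
    (R : ∀ γ : I, (Iio γ → T) → T → Prop) :
    ∃ f : I → T, ∀ γ, (∃ t, R γ (fun δ => f δ) t) → R γ (fun δ => f δ) (f γ) := by
  let f : I → T := (wellFounded_lt (α := I)).fix
    fun γ ih => Classical.epsilon (R γ fun δ => ih δ.1 δ.2)
  refine ⟨f, fun γ hγ => ?_⟩
  have : f γ = Classical.epsilon (R γ fun δ => f δ) := WellFounded.fix_eq _ _ _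
  rw [this]
  exact Classical.epsilon_spec hγ

/-- The filters accumulated up to each stage decrease, so their infimum is directed and stays
proper; this covers limit stages and the end of the recursion. -/
theorem neBot_cofinite_inf_iInf {I : Type*} [LinearOrder I] {N : I → Filter ℕ} (S : Set I)
    (h : ∀ δ ∈ S, (cofinite ⊓ ((⨅ ε : Iio δ, N ε) ⊓ N δ)).NeBot) :
    (cofinite ⊓ ⨅ δ : S, N δ).NeBot := by
  rcases S.eq_empty_or_nonempty with rfl | hS
  · rw [iInf_of_empty, inf_top_eq]
    infer_instance
  · have := hS.to_subtype
    let E (δ : I) : Filter ℕ := cofinite ⊓ ((⨅ ε : Iio δ, N ε) ⊓ N δ)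
    have hE : Antitone E := by
      intro δ δ' hle
      rcases hle.eq_or_lt with rfl | hlt
      · exact le_rfl
      · refine inf_le_inf_left _ (inf_le_left.trans (le_inf ?_ ?_))
        · exact le_iInf fun ε => iInf_le (fun ε : Iio δ' => N ε) ⟨ε, ε.2.trans hlt⟩
        · exact iInf_le (fun ε : Iio δ' => N ε) ⟨δ, hlt⟩
    have hdir : Directed (· ≥ ·) fun δ : S => E δ := fun δ δ' => by
      rcases le_total δ δ' with hle | hle
      · exact ⟨δ', hE hle, le_rfl⟩
      · exact ⟨δ, le_rfl, hE hle⟩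
    have := iInf_neBot_of_directed hdir fun δ => h δ δ.2
    refine this.mono (le_inf ?_ (iInf_mono fun δ => inf_le_right.trans inf_le_right))
    obtain ⟨δ, hδ⟩ := hS
    exact (iInf_le _ ⟨δ, hδ⟩).trans inf_le_left

/-- The union of the intervals `[n, b n)` for `n ∈ P`. -/
def blocks (b : ℕ → ℕ) (P : Set ℕ) : Set ℕ := {m | ∃ n ∈ P, n ≤ m ∧ m < b n}

/-- Two applications of `b` are needed: one reaches the end of the block at `p`, the other bounds `g
n` for any `n` before that end. -/
theorem blocks_separated {b g : ℕ → ℕ} (hb : Monotone b) (hgb : ∀ n, g n ≤ b n) {P Q : Set ℕ}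
    (hPQ : ∀ p ∈ P, ∀ q ∈ Q, b (b p) ≤ q ∨ b (b q) ≤ p) (n : ℕ) :
    ¬ ((∃ m, n ≤ m ∧ m < g n ∧ m ∈ blocks b P) ∧ ∃ m, n ≤ m ∧ m < g n ∧ m ∈ blocks b Q) := by
  rintro ⟨⟨m, hnm, hmg, p, hp, hpm, hmp⟩, ⟨l, hnl, hlg, q, hq, hql, hlq⟩⟩
  have hg := hgb n
  rcases hPQ p hp q hq with h | h
  · have := hb (hnm.trans hmp.le)
    omega
  · have := hb (hnl.trans hlq.le)
    omega

theorem mk_Iio_ord_lt {κ : Cardinal.{0}} (α : κ.ord.ToType) : #(Iio α) < κ := by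
  simpa using mk_Iio_lt α (by simp)

theorem exists_upper_bound_of_mk_lt {κ : Cardinal.{0}} (hκ : κ.IsRegular) {J : Type}
    (hJ : #J < κ) (h : J → κ.ord.ToType) : ∃ β, ∀ j, h j ≤ β := by
  by_contra! hcon
  have huniv : ⋃ j, Iio (h j) = Set.univ := by
    refine eq_univ_of_forall fun β => ?_
    obtain ⟨j, hj⟩ := hcon β
    exact mem_iUnion.2 ⟨j, hj⟩
  have := (card_iUnion_lt_iff_forall_of_isRegular hκ hJ (t := fun j => Iio (h j))).2
    fun j => mk_Iio_ord_lt (h j)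
  rw [huniv, mk_univ, mk_ord_toType] at this
  exact this.false

theorem mk_partial_tuples_lt {κ : Cardinal.{0}} (hκ : ℵ₀ ≤ κ) {J : Type} (hJ : #J < κ) (k : ℕ) :
    #(Fin k → Option J) < κ := by
  have hO : #(Option J) < κ := by
    rw [mk_option]
    exact add_lt_of_lt hκ hJ (one_lt_aleph0.trans_le hκ)
  rw [mk_arrow, lift_id, lift_id, mk_fin]
  rcases lt_or_ge #(Option J) ℵ₀ with h | h
  · exact (power_lt_aleph0 h (natCast_lt_aleph0)).trans_le hκ
  · exact (power_nat_le h).trans_lt hO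

/-- The filter generated at stage `γ` of the construction. -/
def stageFilter {I : Type} [LinearOrder I] (D : I → ℕ → ℕ) (γ : I) (b : ℕ → ℕ) (P : Set ℕ) :
    Filter ℕ :=
  (⨅ β : Iic γ, 𝓟 {n | D β n ≤ b n}) ⊓ 𝓟 P

theorem hasSmallBase_stageFilter {κ : Cardinal.{0}} (hκ : κ.IsRegular)
    (D : κ.ord.ToType → ℕ → ℕ) (γ : κ.ord.ToType) (b : ℕ → ℕ) (P : Set ℕ) :
    HasSmallBase κ (stageFilter D γ b P) := by
  refine .inf hκ.aleph0_le (.iInf hκ ?_ fun _ => .principal hκ.aleph0_le _)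
    (.principal hκ.aleph0_le _)
  rw [← Iio_insert]
  exact mk_insert_le.trans_lt (add_lt_of_lt hκ.aleph0_le (mk_Iio_ord_lt γ)
    (one_lt_aleph0.trans_le hκ.aleph0_le))

theorem exists_scales (hdr : dominatingNumber ≤ reapingNumber) (hreg : dominatingNumber.IsRegular)
    {D : dominatingNumber.ord.ToType → ℕ → ℕ} (hD : ∀ α, Monotone (D α)) :
    ∃ (b : dominatingNumber.ord.ToType → ℕ → ℕ) (P Q : dominatingNumber.ord.ToType → Set ℕ),
      (∀ α, Monotone (b α) ∧ (∀ n, n < b α n) ∧ (∀ n, D α n ≤ b α n) ∧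
        ∀ p ∈ P α, ∀ q ∈ Q α, b α (b α p) ≤ q ∨ b α (b α q) ≤ p) ∧
      (cofinite ⊓ ⨅ α, stageFilter D α (b α) (P α)).NeBot ∧
      (cofinite ⊓ ⨅ α, stageFilter D α (b α) (Q α)).NeBot := by
  let T : Type := (ℕ → ℕ) × Set ℕ × Set ℕ
  let N (γ : dominatingNumber.ord.ToType) (t : T) : Filter ℕ := stageFilter D γ t.1 t.2.1
  let N' (γ : dominatingNumber.ord.ToType) (t : T) : Filter ℕ := stageFilter D γ t.1 t.2.2
  obtain ⟨f, hf⟩ := exists_transfinite_rec (I := dominatingNumber.ord.ToType) (T := T)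
    fun γ g t => (Monotone t.1 ∧ (∀ n, n < t.1 n) ∧ (∀ n, D γ n ≤ t.1 n) ∧
      ∀ p ∈ t.2.1, ∀ q ∈ t.2.2, t.1 (t.1 p) ≤ q ∨ t.1 (t.1 q) ≤ p) ∧
      (cofinite ⊓ ((⨅ δ : Iio γ, N δ (g δ)) ⊓ N γ t)).NeBot ∧
      (cofinite ⊓ ((⨅ δ : Iio γ, N' δ (g δ)) ⊓ N' γ t)).NeBot
  have hd := hreg.aleph0_le
  have main (γ) := WellFoundedLT.induction (motive := fun γ => _) γ fun γ ih => hf γ <| by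
    have hF := neBot_cofinite_inf_iInf (N := fun δ => N δ (f δ)) (Iio γ) fun δ hδ => (ih δ hδ).2.1
    have hG := neBot_cofinite_inf_iInf (N := fun δ => N' δ (f δ)) (Iio γ) fun δ hδ => (ih δ hδ).2.2
    have hFs : HasSmallBase dominatingNumber (⨅ δ : Iio γ, N δ (f δ)) :=
      .iInf hreg (mk_Iio_ord_lt γ) fun _ => hasSmallBase_stageFilter hreg ..
    have hGs : HasSmallBase dominatingNumber (⨅ δ : Iio γ, N' δ (f δ)) :=
      .iInf hreg (mk_Iio_ord_lt γ) fun _ => hasSmallBase_stageFilter hreg ..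
    have hT : #(Iic γ) < dominatingNumber := by
      rw [← Iio_insert]
      exact mk_insert_le.trans_lt (add_lt_of_lt hd (mk_Iio_ord_lt γ)
        (one_lt_aleph0.trans_le hd))
    obtain ⟨b, hb, hlt, hDb, hFb, hGb⟩ := exists_growth hd hFs hGs hF hG hT (fun β => D β) (hD γ)
    have hs : HasSmallBase dominatingNumber (⨅ β : Iic γ, 𝓟 {n | D β n ≤ b n}) :=
      .iInf hreg hT fun _ => .principal hd _
    obtain ⟨P, Q, hP, hQ, hPQ⟩ := exists_separation hd hdr (hFs.inf hd hs) (hGs.inf hd hs) hFb hGb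
      -- The double iterate is the distance demanded by `blocks_separated`.
      (h := fun n => b (b n)) (hb.comp hb) fun n => (hlt n).trans (hlt _)
    rw [inf_assoc] at hP hQ
    exact ⟨(b, P, Q), ⟨hb, hlt, hDb, hPQ⟩, hP, hQ⟩
  refine ⟨fun α => (f α).1, fun α => (f α).2.1, fun α => (f α).2.2, fun α => (main α).1, ?_, ?_⟩
  · have := neBot_cofinite_inf_iInf (N := fun δ => N δ (f δ)) Set.univ fun δ _ => (main δ).2.1
    exact this.mono (inf_le_inf_left _ (le_iInf fun α => iInf_le _ (⟨α, mem_univ α⟩ : Set.univ)))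
  · have := neBot_cofinite_inf_iInf (N := fun δ => N' δ (f δ)) Set.univ fun δ _ => (main δ).2.2
    exact this.mono (inf_le_inf_left _ (le_iInf fun α => iInf_le _ (⟨α, mem_univ α⟩ : Set.univ)))

/-! ### Coded sets and their transfer to the reals -/

/-- The points of the Cantor space coding the sets `blocks (b α) (P α)` and the cofinite sets. -/
def codes {I : Type} (b : I → ℕ → ℕ) (P : I → Set ℕ) : Set (ℕ → Bool) :=
  {z | (∃ N, ∀ n ≥ N, z n = true) ∨ ∃ α, ∀ n, z n = true ↔ n ∈ blocks (b α) (P α)}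

theorem exists_mem_codes {I : Type} (b : I → ℕ → ℕ) (P : I → Set ℕ) (α : I) :
    ∃ z ∈ codes b P, ∀ n, z n = true ↔ n ∈ blocks (b α) (P α) := by
  classical
  have h (n : ℕ) : decide (n ∈ blocks (b α) (P α)) = true ↔ n ∈ blocks (b α) (P α) :=
    decide_eq_true_iff
  exact ⟨fun n => decide (n ∈ blocks (b α) (P α)), Or.inr ⟨α, h⟩, h⟩

section Codes

variable {κ : Cardinal.{0}} {D b : κ.ord.ToType → ℕ → ℕ} {P : κ.ord.ToType → Set ℕ}

theorem codes_infinite (hlt : ∀ α n, n < b α n)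
    (hP : (cofinite ⊓ ⨅ α, stageFilter D α (b α) (P α)).NeBot) {z : ℕ → Bool}
    (hz : z ∈ codes b P) (n : ℕ) : ∃ m ≥ n, z m = true := by
  rcases hz with ⟨N, hN⟩ | ⟨α, hα⟩
  · exact ⟨max n N, le_max_left _ _, hN _ (le_max_right _ _)⟩
  · have hPα : (P α).Infinite := neBot_cofinite_inf_iff.1 hP _ <|
      mem_iInf_of_mem α (mem_inf_of_right (mem_principal_self _))
    obtain ⟨m, hm, hnm⟩ := hPα.exists_gt n
    exact ⟨m, hnm.le, (hα m).2 ⟨m, hm, le_rfl, hlt α m⟩⟩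

theorem allFinitePowersMenger_codes (hreg : κ.IsRegular)
    (hD : ∀ f : ℕ → ℕ, ∃ α, ∀ n, f n ≤ D α n)
    (hP : (cofinite ⊓ ⨅ α, stageFilter D α (b α) (P α)).NeBot)
    {X : Type*} [TopologicalSpace X] {ι : X → ℕ → Bool} (hι : IsEmbedding ι)
    (hX : range ι = codes b P) : AllFinitePowersMenger X := by
  have : Nonempty κ.ord.ToType := nonempty_ord_toType hreg.ne_zero
  have hmem (z) (hz : z ∈ codes b P) : ∃ x, ι x = z := by rwa [← hX] at hz
  have hu (α) : ∃ x, ∀ n, ι x n = true ↔ n ∈ blocks (b α) (P α) := by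
    obtain ⟨z, hz, hzα⟩ := exists_mem_codes b P α
    obtain ⟨x, rfl⟩ := hmem z hz
    exact ⟨x, hzα⟩
  choose u hu using hu
  have hscale (f : ℕ → ℕ) : ∃ β, ∀ α ≥ β,
      ∀ᶠ n in cofinite ⊓ ⨅ α, stageFilter D α (b α) (P α), f n ≤ b α n := by
    obtain ⟨β, hβ⟩ := hD f
    refine ⟨β, fun α hα => ?_⟩
    have h1 : {n | D β n ≤ b α n} ∈ stageFilter D α (b α) (P α) :=
      mem_inf_of_left (iInf_le (fun β : Iic α => 𝓟 {n | D β n ≤ b α n}) ⟨β, hα⟩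
        (mem_principal_self _))
    filter_upwards [mem_inf_of_right (mem_iInf_of_mem α h1)] with n hn using (hβ n).trans hn
  refine allFinitePowersMenger_of_scale (u := u) (b := b) inf_le_left hι.isInducing
    (fun z hz => hmem z (Or.inl hz)) (fun x => ?_) hscale (fun f => ?_) fun α k h => ?_
  · rcases hX.le (mem_range_self x) with h | ⟨α, hα⟩
    · exact Or.inl h
    · refine Or.inr ⟨α, hι.injective (funext fun n => ?_)⟩
      rw [Bool.eq_iff_iff, hα, hu]
  · obtain ⟨β, hβ⟩ := hscale f
    refine ⟨β, fun α hα => ?_⟩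
    have h1 : P α ∈ stageFilter D α (b α) (P α) := mem_inf_of_right (mem_principal_self _)
    filter_upwards [hβ α hα, mem_inf_of_right (mem_iInf_of_mem α h1)] with n hn hnP m hnm hm
    exact (hu α m).2 ⟨n, hnP, hnm, hm.trans_le hn⟩
  · exact exists_upper_bound_of_mk_lt hreg
      (mk_partial_tuples_lt hreg.aleph0_le (mk_Iio_ord_lt α) k) h

end Codes

theorem exists_isEmbedding_cantor_real : ∃ e : (ℕ → Bool) → ℝ, IsEmbedding e :=
  ⟨fun z => cantorSetHomeomorphNatToBool.symm z,
    IsEmbedding.subtypeVal.comp cantorSetHomeomorphNatToBool.symm.isEmbedding⟩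

theorem exists_isEmbedding_of_image {Z R : Type*} [TopologicalSpace Z] [TopologicalSpace R]
    {e : Z → R} (he : IsEmbedding e) (S : Set Z) :
    ∃ ι : e '' S → Z, IsEmbedding ι ∧ range ι = S := by
  choose ι hιS hι using fun x : e '' S => x.2
  have heq : e ∘ ι = Subtype.val := funext hι
  refine ⟨ι, he.of_comp_iff.1 (heq ▸ IsEmbedding.subtypeVal), ?_⟩
  ext z
  refine ⟨?_, fun hz => ⟨⟨e z, z, hz, rfl⟩, he.injective (hι _)⟩⟩
  rintro ⟨x, rfl⟩
  exact hιS x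

/-- Two sets of reals that are Menger in all finite powers, with a union that is not Scheepers and
a product that is not Menger. -/
theorem exists_menger_powers_pair (hdr : dominatingNumber ≤ reapingNumber)
    (hreg : dominatingNumber.IsRegular) :
    ∃ X Y : Set ℝ, AllFinitePowersMenger X ∧ AllFinitePowersMenger Y ∧
      ¬ Scheepers (X ∪ Y : Set ℝ) ∧ ¬ Menger (X × Y) := by
  obtain ⟨D, hDm, hD⟩ := exists_dominating_family hreg.aleph0_le
  obtain ⟨b, P, Q, hb, hP, hQ⟩ := exists_scales hdr hreg hDm
  obtain ⟨e, he⟩ := exists_isEmbedding_cantor_real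
  -- The index `α` with `f ≤ D α` everywhere supplies both points; domination at all `n` matters,
  -- since no stage may catch the pair.
  have hsep (f : ℕ → ℕ) : ∃ x ∈ codes b P, ∃ y ∈ codes b Q, ∀ n,
      ¬ ((∃ m, n ≤ m ∧ m < f n ∧ x m = true) ∧ ∃ m, n ≤ m ∧ m < f n ∧ y m = true) := by
    obtain ⟨α, hα⟩ := hD f
    obtain ⟨x, hx, hxα⟩ := exists_mem_codes b P α
    obtain ⟨y, hy, hyα⟩ := exists_mem_codes b Q α
    refine ⟨x, hx, y, hy, fun n => ?_⟩
    simp only [hxα, hyα]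
    exact blocks_separated (hb α).1 (fun n => (hα n).trans ((hb α).2.2.1 n)) (hb α).2.2.2 n
  have hinf {z} (hz : z ∈ codes b P ∪ codes b Q) (n : ℕ) : ∃ m ≥ n, z m = true :=
    hz.elim (fun h => codes_infinite (fun α => (hb α).2.1) hP h n)
      fun h => codes_infinite (fun α => (hb α).2.1) hQ h n
  obtain ⟨ι, hι, hιr⟩ := exists_isEmbedding_of_image he (codes b P)
  obtain ⟨ι', hι', hιr'⟩ := exists_isEmbedding_of_image he (codes b Q)
  refine ⟨e '' codes b P, e '' codes b Q, allFinitePowersMenger_codes hreg hD hP hι hιr,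
    allFinitePowersMenger_codes hreg hD hQ hι' hιr', ?_, ?_⟩
  · rw [← image_union]
    obtain ⟨ρ, hρ, hρr⟩ := exists_isEmbedding_of_image he (codes b P ∪ codes b Q)
    refine not_scheepers_of_hitting hρ.continuous
      (fun w => hinf (hρr.le (mem_range_self w))) fun f => ?_
    obtain ⟨x, hx, y, hy, hxy⟩ := hsep f
    obtain ⟨x, rfl⟩ := hρr.ge (Or.inl hx)
    obtain ⟨y, rfl⟩ := hρr.ge (Or.inr hy)
    exact ⟨x, y, hxy⟩
  · refine not_menger_prod_of_hitting hι.continuous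
      (fun w => hinf (Or.inl (hιr.le (mem_range_self w)))) hι'.continuous
      (fun w => hinf (Or.inr (hιr'.le (mem_range_self w)))) fun f => ?_
    obtain ⟨x, hx, y, hy, hxy⟩ := hsep f
    obtain ⟨x, rfl⟩ := hιr.ge hx
    obtain ⟨y, rfl⟩ := hιr'.ge hy
    exact ⟨x, y, hxy⟩

theorem Scheepers.menger {X : Type*} [TopologicalSpace X] (h : Scheepers X) :
    Menger X := by
  intro U hU
  obtain ⟨F, hF, hFc⟩ := h U hU
  refine ⟨F, hF, eq_univ_of_forall fun x => ?_⟩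
  obtain ⟨n, hn⟩ := hFc {x} (finite_singleton x)
  exact mem_iUnion.2 ⟨n, hn rfl⟩

end MengerProducts

theorem theorem2p5
    (hdr : MengerProducts.dominatingNumber ≤ MengerProducts.reapingNumber)
    (hreg : MengerProducts.dominatingNumber.IsRegular) :
    (∃ X Y : Set ℝ,
      MengerProducts.AllFinitePowersMenger X ∧ MengerProducts.AllFinitePowersMenger Y ∧
      ¬ MengerProducts.Scheepers (X ∪ Y : Set ℝ) ∧ ¬ MengerProducts.Menger (X × Y)) ∧
    ¬ MengerProducts.IsAdditive (fun X _ => MengerProducts.Scheepers X) ∧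
    ¬ MengerProducts.IsProductive (fun X _ => MengerProducts.Scheepers X) := by
  obtain ⟨X, Y, hX, hY, hunion, hprod⟩ := MengerProducts.exists_menger_powers_pair hdr hreg
  exact ⟨⟨X, Y, hX, hY, hunion, hprod⟩, fun h => hunion (h X Y hX.scheepers hY.scheepers),
    fun h => hprod (h X Y hX.scheepers hY.scheepers).menger⟩
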